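/- Let $K\subset\mathbb{R}^n$ be a convex body, i.e. a compact convex set with non-empty interior, and let $u\in\mathbb{R}^n$ be a unit vector. Let $|\cdot|$ denote Lebesgue measure of the appropriate dimension, and $P_{\theta^\perp}$ the orthogonal projection onto the hyperplane $\theta^\perp$. For a set $L\subset\mathbb{R}^n$ and $y\in u^\perp$ write $$L(y)=\{s\in\mathbb{R} : y+su\in L\}$$ for the one-dimensional section of $L$ parallel to $u$ at $y$. The Steiner symmetral $S_uK$ of $K$ in the direction $u$ is the set $$S_uK=\{y+su : y\in u^\perp,\ s\in\mathbb{R},\ K(y)\neq\emptyset,\ |s|\le \tfrac12|K(y)|\}.$$ The projection body $\Pi K$ is the compact convex set whose support function $h_{\Pi K}(\theta)=\max_{x\in\Pi K}\langle\theta,x\rangle$ satisfies $h_{\Pi K}(\theta)=|P_{\theta^\perp}K|$ for every unit vector $\theta$; equivalently, $\Pi K=\{x : \langle\theta,x\rangle\le|P_{\theta^\perp}K| \text{ for all unit } \theta\}$. The polar projection body is $\Pi^*K=(\Pi K)^\circ=\{x : \langle x,z\rangle\le 1\text{ for all }z\in\Pi K\}$. Then for every $y\in u^\perp$, $$|(\Pi^*K)(y)|\le|(\Pi^*S_uK)(y)|,$$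 and consequently $$|\Pi^*K|\le|\Pi^*S_uK|.$$ -/

import Mathlib

open MeasureTheory
open scoped RealInnerProductSpace

/-- The one-dimensional section `L(y) = {s : ℝ | y + s u ∈ L}` of `L` parallel to `u` at `y`. -/
def lineSection {n : ℕ} (u : EuclideanSpace ℝ (Fin n)) (L : Set (EuclideanSpace ℝ (Fin n)))
    (y : EuclideanSpace ℝ (Fin n)) : Set ℝ :=
  {s : ℝ | y + s • u ∈ L}

/-- The Steiner symmetral `S_u K` of a (compact) set `K` in the direction of a unit vector `u`:
over every `y ∈ u^⊥` for which the section of `K` parallel to `u` at `y` is non-empty, it has as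
its section the closed interval centred at `0` of the same length. -/
def steinerSymmetral {n : ℕ} (u : EuclideanSpace ℝ (Fin n)) (K : Set (EuclideanSpace ℝ (Fin n))) :
    Set (EuclideanSpace ℝ (Fin n)) :=
  {x | ∃ y ∈ (ℝ ∙ u)ᗮ, ∃ s : ℝ, x = y + s • u ∧ (lineSection u K y).Nonempty ∧
    |s| ≤ volume.real (lineSection u K y) / 2}

/-- The support function `h_L(x) = max_{y ∈ L} ⟪x, y⟫` of a (non-empty compact) set `L`. -/
noncomputable def supportFunction {n : ℕ} (L : Set (EuclideanSpace ℝ (Fin n)))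
    (x : EuclideanSpace ℝ (Fin n)) : ℝ :=
  sSup ((fun y => ⟪x, y⟫) '' L)

/-- The polar set `{x | h_L(x) ≤ 1}`, written without the maximum. -/
def polarBody {n : ℕ} (L : Set (EuclideanSpace ℝ (Fin n))) : Set (EuclideanSpace ℝ (Fin n)) :=
  {x | ∀ y ∈ L, ⟪x, y⟫ ≤ 1}

theorem polarBody_eq_supportFunction_le_one {n : ℕ} (L : Set (EuclideanSpace ℝ (Fin n)))
    (hcomp : IsCompact L) (hne : L.Nonempty) :
    polarBody L = {x | supportFunction L x ≤ 1} := by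
  ext x
  constructor
  · intro hx
    change supportFunction L x ≤ 1
    apply csSup_le (hne.image _)
    rintro _ ⟨y, hy, rfl⟩
    exact hx y hy
  · intro hx y hy
    have hb : BddAbove ((fun y => ⟪x, y⟫) '' L) := (hcomp.image (by fun_prop)).bddAbove
    exact (le_csSup hb ⟨y, hy, rfl⟩).trans hx

/-- The Lebesgue measure `|P_{θ^⊥} K|` (in the subspace `θ^⊥`) of the orthogonal projection of `K`
onto `θ^⊥`. -/
noncomputable def projectionVolume {n : ℕ} (K : Set (EuclideanSpace ℝ (Fin n)))
    (θ : EuclideanSpace ℝ (Fin n)) : ℝ :=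
  volume.real ((ℝ ∙ θ)ᗮ.orthogonalProjectionOnto '' K)

/-- The projection body `Π K`: the convex body whose support function is `θ ↦ |P_{θ^⊥} K|` on the
unit sphere. A compact convex set is the intersection of its supporting half-spaces, and it is
written here as that intersection; see `projectionBody_eq_of_supportFunction`. -/
def projectionBody {n : ℕ} (K : Set (EuclideanSpace ℝ (Fin n))) : Set (EuclideanSpace ℝ (Fin n)) :=
  {x | ∀ θ : EuclideanSpace ℝ (Fin n), ‖θ‖ = 1 → ⟪θ, x⟫ ≤ projectionVolume K θ}

/-- Whenever a convex body `L` has the support function that defines the projection body of `K`,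
then `projectionBody K` is that body. -/
theorem projectionBody_eq_of_supportFunction {n : ℕ} (K L : Set (EuclideanSpace ℝ (Fin n)))
    (hconv : Convex ℝ L) (hcomp : IsCompact L) (hne : L.Nonempty)
    (hL : ∀ θ : EuclideanSpace ℝ (Fin n), ‖θ‖ = 1 → supportFunction L θ = projectionVolume K θ) :
    projectionBody K = L := by
  have hbdd : ∀ θ : EuclideanSpace ℝ (Fin n), BddAbove ((fun y => ⟪θ, y⟫) '' L) := fun θ =>
    (hcomp.image (by fun_prop)).bddAbove
  ext x
  constructor
  · intro hx
    by_contra hxL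
    obtain ⟨f, c, hf, hc⟩ := geometric_hahn_banach_closed_point hconv hcomp.isClosed hxL
    set v := (InnerProductSpace.toDual ℝ (EuclideanSpace ℝ (Fin n))).symm f with hv
    have hfv : ∀ z, f z = ⟪v, z⟫ := fun z => by simp [hv]
    obtain ⟨a, ha⟩ := hne
    have hv0 : v ≠ 0 := by
      intro h0
      have h1 := hf a ha
      simp only [hfv, h0, inner_zero_left] at h1 hc
      linarith
    have hpos : 0 < ‖v‖ := norm_pos_iff.mpr hv0
    have hunit : ‖(‖v‖⁻¹ • v)‖ = 1 := by
      rw [norm_smul, norm_inv, norm_norm, inv_mul_cancel₀ hpos.ne']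
    have h2 := hx _ hunit
    rw [← hL _ hunit] at h2
    have h3 : supportFunction L (‖v‖⁻¹ • v) ≤ ‖v‖⁻¹ * c := by
      apply csSup_le (Set.Nonempty.image _ ⟨a, ha⟩)
      rintro _ ⟨b, hb, rfl⟩
      have h4 := hf b hb
      rw [hfv] at h4
      simp only [real_inner_smul_left]
      exact mul_le_mul_of_nonneg_left h4.le (inv_nonneg.mpr hpos.le)
    rw [real_inner_smul_left, ← hfv] at h2
    have h5 := mul_lt_mul_of_pos_left hc (inv_pos.mpr hpos)
    linarith
  · intro hx θ hθ
    rw [← hL θ hθ]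
    exact le_csSup (hbdd θ) ⟨x, hx, rfl⟩

/-- The polar projection body `Π* K = (Π K)°`. -/
def polarProjectionBody {n : ℕ} (K : Set (EuclideanSpace ℝ (Fin n))) :
    Set (EuclideanSpace ℝ (Fin n)) :=
  polarBody (projectionBody K)

/-! For convex compact `K`, Fubini along lines parallel to θ gives |K + [0,θ]| - |K| = ‖θ‖ |P_{θ^⊥}
K|. So the support function of Π K is a volume increment (`segmentIncrement`), which is sublinear,
and Π* K is the set where it is at most 1 (`mem_polarProjectionBody_iff`).

The core estimate is, for y ⟂ u and real s, r, h_{Π S_u K}(y + ((s - r)/2) u) ≤ (h_{Π K}(y + s u) +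
h_{Π K}(y + r u)) / 2 (`segmentIncrement_steinerSymmetral_le`). Since |S_u K| = |K|, it suffices to
compare volumes of sums with segments, and by Fubini along u, lengths of sections. These are
compared by writing each point of a section of S_u K as half a difference of two points of the
section of K.

Hence if a, b lie in (Π* K)(y), then ±(a - b)/2 lie in (Π* S_u K)(y). That section is convex, so its
length is at least |a - b|. A last use of Fubini gives the volume inequality. -/

open scoped Pointwise

/-! ### Sections parallel to a unit vector and Fubini's theorem -/

section LineSection

variable {n : ℕ} {u : EuclideanSpace ℝ (Fin n)} {K : Set (EuclideanSpace ℝ (Fin n))}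

/-- Cartesian coordinates along a unit vector `u`: the isometry `(y, s) ↦ y + s u`. -/
noncomputable def lineCoordinates (u : EuclideanSpace ℝ (Fin n)) (hu : ‖u‖ = 1) :
    WithLp 2 ((ℝ ∙ u)ᗮ × ℝ) ≃ₗᵢ[ℝ] EuclideanSpace ℝ (Fin n) :=
  LinearIsometryEquiv.ofSurjective
    { toFun := fun p => (p.fst : EuclideanSpace ℝ (Fin n)) + p.snd • u
      map_add' := fun p q => by
        simp only [WithLp.add_fst, WithLp.add_snd, Submodule.coe_add, add_smul]; abel
      map_smul' := fun c p => by
        simp only [WithLp.smul_fst, WithLp.smul_snd, Submodule.coe_smul, smul_add, smul_smul,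
          smul_eq_mul, RingHom.id_apply]
      norm_map' := fun p => by
        have h0 : ⟪(p.fst : EuclideanSpace ℝ (Fin n)), p.snd • u⟫ = 0 := by
          rw [real_inner_smul_right, Submodule.mem_orthogonal_singleton_iff_inner_left.1 p.fst.2,
            mul_zero]
        have h1 := norm_add_sq_eq_norm_sq_add_norm_sq_of_inner_eq_zero _ _ h0
        have h2 := WithLp.prod_norm_sq_eq_of_L2 p
        rw [norm_smul, hu, mul_one] at h1
        have h3 : ‖(p.fst : EuclideanSpace ℝ (Fin n)) + p.snd • u‖ ^ 2 = ‖p‖ ^ 2 := by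
          rw [h2, sq, h1, Submodule.coe_norm]; ring
        exact (pow_left_inj₀ (norm_nonneg _) (norm_nonneg _) two_ne_zero).1 h3 }
    (fun x => by
      refine ⟨WithLp.toLp 2 ((ℝ ∙ u)ᗮ.orthogonalProjectionOnto x, ⟪u, x⟫), ?_⟩
      have h := Submodule.starProjection_add_starProjection_orthogonal (K := ℝ ∙ u) x
      rw [Submodule.starProjection_unit_singleton ℝ hu, add_comm] at h
      exact h)

theorem lineCoordinates_apply (hu : ‖u‖ = 1) (p : WithLp 2 ((ℝ ∙ u)ᗮ × ℝ)) :
    lineCoordinates u hu p = (p.fst : EuclideanSpace ℝ (Fin n)) + p.snd • u := rfl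

theorem measurableSet_lineCoordinates_preimage (hK : MeasurableSet K) :
    MeasurableSet {p : (ℝ ∙ u)ᗮ × ℝ | (p.1 : EuclideanSpace ℝ (Fin n)) + p.2 • u ∈ K} :=
  hK.preimage (by fun_prop :
    Continuous fun p : (ℝ ∙ u)ᗮ × ℝ => (p.1 : EuclideanSpace ℝ (Fin n)) + p.2 • u).measurable

/-- Fubini's theorem along the lines parallel to a unit vector. -/
theorem volume_eq_lintegral_lineSection (hu : ‖u‖ = 1) (hK : MeasurableSet K) :
    volume K = ∫⁻ y : (ℝ ∙ u)ᗮ, volume (lineSection u K y) := by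
  have h := ((lineCoordinates u hu).measurePreserving.comp
    (WithLp.volume_preserving_toLp (ℝ ∙ u)ᗮ ℝ)).measure_preimage hK.nullMeasurableSet
  rw [← h]
  exact Measure.prod_apply (measurableSet_lineCoordinates_preimage hK)

theorem measurable_volume_lineSection (hK : MeasurableSet K) :
    Measurable fun y : (ℝ ∙ u)ᗮ => volume (lineSection u K y) :=
  measurable_measure_prodMk_left (measurableSet_lineCoordinates_preimage hK)

theorem orthogonalProjectionOnto_add_smul (y : (ℝ ∙ u)ᗮ) (s : ℝ) :
    (ℝ ∙ u)ᗮ.orthogonalProjectionOnto ((y : EuclideanSpace ℝ (Fin n)) + s • u) = y := by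
  rw [map_add, map_smul, Submodule.orthogonalProjectionOnto_mem_subspace_eq_self,
    Submodule.orthogonalProjectionOnto_orthogonalComplement_singleton_eq_zero, smul_zero, add_zero]

theorem mem_orthogonalProjectionOnto_image_iff (hu : ‖u‖ = 1) (y : (ℝ ∙ u)ᗮ) :
    y ∈ (ℝ ∙ u)ᗮ.orthogonalProjectionOnto '' K ↔ (lineSection u K y).Nonempty := by
  constructor
  · rintro ⟨x, hx, rfl⟩
    obtain ⟨p, rfl⟩ := (lineCoordinates u hu).surjective x
    rw [lineCoordinates_apply] at hx ⊢
    rw [orthogonalProjectionOnto_add_smul]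
    exact ⟨p.snd, hx⟩
  · rintro ⟨s, hs⟩
    exact ⟨_, hs, orthogonalProjectionOnto_add_smul y s⟩

theorem isCompact_lineSection (hu : ‖u‖ = 1) (hK : IsCompact K) (y : EuclideanSpace ℝ (Fin n)) :
    IsCompact (lineSection u K y) := by
  have hiso : Isometry fun s : ℝ => y + s • u := Isometry.of_dist_eq fun s t => by
    rw [dist_add_left, dist_eq_norm, ← sub_smul, norm_smul, hu, mul_one, dist_eq_norm]
  exact hiso.isClosedEmbedding.isCompact_preimage hK

theorem convex_lineSection (hK : Convex ℝ K) (y : EuclideanSpace ℝ (Fin n)) :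
    Convex ℝ (lineSection u K y) := by
  intro s hs t ht a b ha hb hab
  have h := hK hs ht ha hb hab
  have e : a • (y + s • u) + b • (y + t • u) = y + (a • s + b • t) • u := by
    have hy : y = (a + b) • y := by rw [hab, one_smul]
    conv_rhs => rw [hy]
    module
  rwa [e] at h

theorem exists_lineSection_eq_Icc (hu : ‖u‖ = 1) (hK : IsCompact K) (hc : Convex ℝ K)
    {y : EuclideanSpace ℝ (Fin n)} (hy : (lineSection u K y).Nonempty) :
    ∃ a b : ℝ, a ≤ b ∧ lineSection u K y = Set.Icc a b := by
  have h := eq_Icc_of_connected_compact ((convex_lineSection hc y).isConnected hy)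
    (isCompact_lineSection hu hK y)
  exact ⟨_, _, Set.nonempty_Icc.1 (h ▸ hy), h⟩

end LineSection

/-! ### The support function of the projection body as a volume increment -/

section SegmentIncrement

variable {n : ℕ} {K : Set (EuclideanSpace ℝ (Fin n))}

theorem mem_segment_zero_iff {θ x : EuclideanSpace ℝ (Fin n)} :
    x ∈ segment ℝ 0 θ ↔ ∃ t ∈ Set.Icc (0 : ℝ) 1, t • θ = x := by
  simp [segment_eq_image_lineMap, AffineMap.lineMap_apply]

theorem isCompact_segment_zero (θ : EuclideanSpace ℝ (Fin n)) : IsCompact (segment ℝ 0 θ) := by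
  rw [segment_eq_image_lineMap]
  exact isCompact_Icc.image (by fun_prop)

theorem segment_zero_add_subset (a b : EuclideanSpace ℝ (Fin n)) :
    segment ℝ 0 (a + b) ⊆ segment ℝ 0 a + segment ℝ 0 b := by
  intro x hx
  obtain ⟨t, ht, rfl⟩ := mem_segment_zero_iff.1 hx
  exact ⟨t • a, mem_segment_zero_iff.2 ⟨t, ht, rfl⟩, t • b, mem_segment_zero_iff.2 ⟨t, ht, rfl⟩,
    (smul_add _ _ _).symm⟩

theorem lineSection_add_segment {v : EuclideanSpace ℝ (Fin n)} {c : ℝ} (hc : 0 ≤ c)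
    (y : EuclideanSpace ℝ (Fin n)) :
    lineSection v (K + segment ℝ 0 (c • v)) y = lineSection v K y + Set.Icc 0 c := by
  ext s
  constructor
  · rintro ⟨x, hx, z, hz, hxz⟩
    obtain ⟨t, ht, rfl⟩ := mem_segment_zero_iff.1 hz
    refine ⟨s - t * c, ?_, t * c, ⟨mul_nonneg ht.1 hc, mul_le_of_le_one_left hc ht.2⟩,
      sub_add_cancel _ _⟩
    have e : y + (s - t * c) • v = x := by
      have : x = y + s • v - t • c • v := eq_sub_of_add_eq hxz
      rw [this]; module
    change y + (s - t * c) • v ∈ K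
    rwa [e]
  · rintro ⟨r, hr, t, ht, rfl⟩
    -- The shift `t` sits at parameter `t / c` on the segment, so the degenerate segment is treated
    -- apart.
    rcases hc.eq_or_lt with rfl | hc'
    · have : t = 0 := le_antisymm ht.2 ht.1
      subst this
      exact ⟨_, hr, 0, left_mem_segment _ _ _, by simp⟩
    · refine ⟨_, hr, t • v, mem_segment_zero_iff.2 ⟨t / c,
        ⟨div_nonneg ht.1 hc, div_le_one_of_le₀ ht.2 hc⟩, ?_⟩, ?_⟩
      · rw [smul_smul, div_mul_cancel₀ _ hc'.ne']
      · change y + r • v + t • v = y + (r + t) • v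
        module

/-- The volume of a convex body grows linearly when a segment is added to it, at a rate given by
the volume of the projection along the segment. -/
theorem volume_add_segment (hK : IsCompact K) (hconv : Convex ℝ K)
    {v : EuclideanSpace ℝ (Fin n)} (hv : ‖v‖ = 1) {c : ℝ} (hc : 0 ≤ c) :
    volume (K + segment ℝ 0 (c • v)) =
      volume K + ENNReal.ofReal c * volume ((ℝ ∙ v)ᗮ.orthogonalProjectionOnto '' K) := by
  have hP : MeasurableSet ((ℝ ∙ v)ᗮ.orthogonalProjectionOnto '' K) :=
    (hK.image (ContinuousLinearMap.continuous _)).measurableSet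
  rw [volume_eq_lintegral_lineSection hv (hK.add (isCompact_segment_zero _)).measurableSet,
    volume_eq_lintegral_lineSection hv hK.measurableSet, ← lintegral_indicator_const hP,
    ← lintegral_add_left (measurable_volume_lineSection hK.measurableSet)]
  refine lintegral_congr fun y => ?_
  rw [lineSection_add_segment hc]
  -- Over the projection of `K` the section is an interval, lengthened by exactly `c`; elsewhere
  -- both sections are empty.
  by_cases hy : (lineSection v K y).Nonempty
  · rw [Set.indicator_of_mem ((mem_orthogonalProjectionOnto_image_iff hv y).2 hy)]
    obtain ⟨a, b, hab, h⟩ := exists_lineSection_eq_Icc hv hK hconv hy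
    rw [h, Set.Icc_add_Icc hab hc, Real.volume_Icc, Real.volume_Icc,
      ← ENNReal.ofReal_add (sub_nonneg.2 hab) hc]
    congr 1; ring
  · rw [Set.indicator_of_notMem (mt (mem_orthogonalProjectionOnto_image_iff hv y).1 hy),
      Set.not_nonempty_iff_eq_empty.1 hy]
    simp

/-- The increase of volume when the segment from `0` to `θ` is added to a set. For a convex body
this is the support function of its projection body. -/
noncomputable def segmentIncrement (K : Set (EuclideanSpace ℝ (Fin n)))
    (θ : EuclideanSpace ℝ (Fin n)) : ℝ :=
  volume.real (K + segment ℝ 0 θ) - volume.real K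

theorem segmentIncrement_smul_of_norm_eq_one (hK : IsCompact K) (hconv : Convex ℝ K)
    {v : EuclideanSpace ℝ (Fin n)} (hv : ‖v‖ = 1) {c : ℝ} (hc : 0 ≤ c) :
    segmentIncrement K (c • v) = c * projectionVolume K v := by
  have hP : volume ((ℝ ∙ v)ᗮ.orthogonalProjectionOnto '' K) ≠ ⊤ :=
    (hK.image (ContinuousLinearMap.continuous _)).measure_ne_top
  rw [segmentIncrement, projectionVolume, measureReal_def, measureReal_def, measureReal_def,
    volume_add_segment hK hconv hv hc, ENNReal.toReal_add hK.measure_ne_top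
      (ENNReal.mul_ne_top ENNReal.ofReal_ne_top hP), ENNReal.toReal_mul, ENNReal.toReal_ofReal hc]
  ring

theorem segmentIncrement_zero : segmentIncrement K 0 = 0 := by
  simp [segmentIncrement]

theorem exists_eq_smul_norm_eq_one {θ : EuclideanSpace ℝ (Fin n)} (hθ : θ ≠ 0) :
    ∃ v : EuclideanSpace ℝ (Fin n), ‖v‖ = 1 ∧ θ = ‖θ‖ • v :=
  ⟨‖θ‖⁻¹ • θ, norm_smul_inv_norm hθ, by
    rw [smul_smul, mul_inv_cancel₀ (norm_ne_zero_iff.2 hθ), one_smul]⟩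

theorem segmentIncrement_smul (hK : IsCompact K) (hconv : Convex ℝ K) {c : ℝ} (hc : 0 ≤ c)
    (θ : EuclideanSpace ℝ (Fin n)) :
    segmentIncrement K (c • θ) = c * segmentIncrement K θ := by
  rcases eq_or_ne θ 0 with rfl | hθ
  · simp [segmentIncrement_zero]
  obtain ⟨v, hv, h⟩ := exists_eq_smul_norm_eq_one hθ
  rw [h, smul_smul, segmentIncrement_smul_of_norm_eq_one hK hconv hv (by positivity),
    segmentIncrement_smul_of_norm_eq_one hK hconv hv (norm_nonneg _), mul_assoc]

/-- Since [0, t(a+b)] ⊆ [0, ta] + [0, tb], monotonicity of volume bounds the increment along t(a+b)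
by adding the two segments successively. Evaluating |K + [0, ta] + [0, b]| in either order shows
that the increment of K + [0, ta] along b differs from that of K by t * C. Dividing by t and letting
t → 0+ removes this error. -/
theorem segmentIncrement_add_le (hK : IsCompact K) (hconv : Convex ℝ K)
    (a b : EuclideanSpace ℝ (Fin n)) :
    segmentIncrement K (a + b) ≤ segmentIncrement K a + segmentIncrement K b := by
  set C := segmentIncrement (K + segment ℝ 0 b) a - segmentIncrement K a with hC
  have key : ∀ t : ℝ, 0 < t →
      segmentIncrement K (a + b) ≤ segmentIncrement K a + segmentIncrement K b + t * C := by
    intro t ht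
    have hKb : IsCompact (K + segment ℝ 0 b) := hK.add (isCompact_segment_zero _)
    have hKa : IsCompact (K + segment ℝ 0 (t • a)) := hK.add (isCompact_segment_zero _)
    have hcb : Convex ℝ (K + segment ℝ 0 b) := hconv.add (convex_segment _ _)
    have hca : Convex ℝ (K + segment ℝ 0 (t • a)) := hconv.add (convex_segment _ _)
    have hmono : volume.real (K + segment ℝ 0 (t • (a + b))) ≤
        volume.real (K + segment ℝ 0 (t • a) + segment ℝ 0 (t • b)) := by
      refine measureReal_mono ?_ (hKa.add (isCompact_segment_zero _)).measure_ne_top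
      rw [add_assoc, smul_add]
      exact Set.add_subset_add_left (segment_zero_add_subset _ _)
    have h1 := segmentIncrement_smul hK hconv ht.le (a + b)
    have h2 := segmentIncrement_smul hK hconv ht.le a
    have h3 := segmentIncrement_smul hKa hca ht.le b
    have h4 := segmentIncrement_smul hKb hcb ht.le a
    have hcomm : K + segment ℝ 0 b + segment ℝ 0 (t • a) =
        K + segment ℝ 0 (t • a) + segment ℝ 0 b := add_right_comm _ _ _
    simp only [segmentIncrement] at h1 h2 h3 h4 hC ⊢
    rw [hcomm] at h4
    refine le_of_mul_le_mul_left ?_ ht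
    rw [hC]
    linear_combination hmono - h1 + h2 + h3 + t * h4 - t * h2
  have hlim : Filter.Tendsto (fun t : ℝ => segmentIncrement K a + segmentIncrement K b + t * C)
      (nhdsWithin 0 (Set.Ioi 0)) (nhds (segmentIncrement K a + segmentIncrement K b + 0 * C)) :=
    ((by fun_prop : Continuous fun t : ℝ =>
      segmentIncrement K a + segmentIncrement K b + t * C).tendsto 0).mono_left nhdsWithin_le_nhds
  rw [zero_mul, add_zero] at hlim
  exact ge_of_tendsto hlim (by filter_upwards [self_mem_nhdsWithin] with t ht using key t ht)

/-- The polar projection body is the unit ball of the gauge `segmentIncrement K`. -/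
theorem mem_polarProjectionBody_iff (hK : IsCompact K) (hconv : Convex ℝ K)
    (θ : EuclideanSpace ℝ (Fin n)) :
    θ ∈ polarProjectionBody K ↔ segmentIncrement K θ ≤ 1 := by
  constructor
  · intro hθ
    rcases eq_or_ne θ 0 with rfl | hθ0
    · rw [segmentIncrement_zero]; exact zero_le_one
    -- Hahn–Banach yields a linear functional dominated by the increment and equal to it at θ. Its
    -- Riesz vector lies in Π K and attains the support value there.
    obtain ⟨g, hg, hle⟩ := exists_extension_of_le_sublinear
      (LinearPMap.mkSpanSingleton θ (segmentIncrement K θ) hθ0) (segmentIncrement K)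
      (fun c hc x => segmentIncrement_smul hK hconv hc.le x)
      (segmentIncrement_add_le hK hconv) (by
        rintro ⟨x, hx⟩
        obtain ⟨c, rfl⟩ := Submodule.mem_span_singleton.1 hx
        refine (LinearPMap.mkSpanSingleton'_apply _ _ _ c hx).trans_le ?_
        rw [smul_eq_mul]
        rcases le_total 0 c with hc | hc
        · exact (segmentIncrement_smul hK hconv hc θ).ge
        · have h1 := segmentIncrement_add_le hK hconv (c • θ) ((-c) • θ)
          rw [← add_smul, add_neg_cancel, zero_smul, segmentIncrement_zero,
            segmentIncrement_smul hK hconv (neg_nonneg.2 hc)] at h1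
          change c * segmentIncrement K θ ≤ segmentIncrement K (c • θ)
          linarith)
    have hgθ : g θ = segmentIncrement K θ := by
      rw [hg ⟨θ, Submodule.mem_span_singleton_self θ⟩]
      exact LinearPMap.mkSpanSingleton'_apply_self _ _ _ _
    set z := (InnerProductSpace.toDual ℝ (EuclideanSpace ℝ (Fin n))).symm
      (LinearMap.toContinuousLinearMap g) with hz
    have hgz : ∀ x, ⟪x, z⟫ = g x := fun x => by
      rw [real_inner_comm, hz, InnerProductSpace.toDual_symm_apply]; rfl
    have hmem : z ∈ projectionBody K := fun v hv => by
      have h := segmentIncrement_smul_of_norm_eq_one hK hconv hv zero_le_one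
      rw [one_smul, one_mul] at h
      rw [hgz, ← h]
      exact hle v
    rw [← hgθ, ← hgz]
    exact hθ z hmem
  · intro hθ z hz
    rcases eq_or_ne θ 0 with rfl | hθ0
    · rw [inner_zero_left]; exact zero_le_one
    obtain ⟨v, hv, h⟩ := exists_eq_smul_norm_eq_one hθ0
    refine le_trans ?_ hθ
    rw [h, segmentIncrement_smul_of_norm_eq_one hK hconv hv (norm_nonneg _), real_inner_smul_left]
    exact mul_le_mul_of_nonneg_left (hz v hv) (norm_nonneg _)

theorem isClosed_polarBody (L : Set (EuclideanSpace ℝ (Fin n))) : IsClosed (polarBody L) := by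
  simp only [polarBody, Set.ofPred_forall]
  exact isClosed_biInter fun y _ => isClosed_le (by fun_prop) continuous_const

theorem convex_polarBody (L : Set (EuclideanSpace ℝ (Fin n))) : Convex ℝ (polarBody L) := by
  simp only [polarBody, Set.ofPred_forall]
  refine convex_iInter₂ fun y _ => ?_
  exact convex_halfSpace_le ⟨fun a b => inner_add_left a b y, fun c a => by
    rw [real_inner_smul_left, smul_eq_mul]⟩ 1

end SegmentIncrement

/-! ### Steiner symmetrization and the comparison of sections -/

section Steiner

variable {n : ℕ} {u : EuclideanSpace ℝ (Fin n)} {K : Set (EuclideanSpace ℝ (Fin n))}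

theorem inner_eq_zero_of_mem_orthogonal_span {y : EuclideanSpace ℝ (Fin n)} (hy : y ∈ (ℝ ∙ u)ᗮ) :
    ⟪u, y⟫ = 0 :=
  Submodule.mem_orthogonal_singleton_iff_inner_right.1 hy

theorem inner_add_smul_of_mem_orthogonal (hu : ‖u‖ = 1) {y : EuclideanSpace ℝ (Fin n)}
    (hy : y ∈ (ℝ ∙ u)ᗮ) (s : ℝ) : ⟪u, y + s • u⟫ = s := by
  rw [inner_add_right, inner_eq_zero_of_mem_orthogonal_span hy, real_inner_smul_right,
    real_inner_self_eq_norm_sq, hu]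
  ring

theorem mem_lineSection_steinerSymmetral_iff (hu : ‖u‖ = 1) {y : EuclideanSpace ℝ (Fin n)}
    (hy : y ∈ (ℝ ∙ u)ᗮ) {s : ℝ} :
    s ∈ lineSection u (steinerSymmetral u K) y ↔
      (lineSection u K y).Nonempty ∧ |s| ≤ volume.real (lineSection u K y) / 2 := by
  constructor
  · rintro ⟨y', hy', s', h, hne, hs⟩
    have e : s = s' := by
      rw [← inner_add_smul_of_mem_orthogonal hu hy s, h, inner_add_smul_of_mem_orthogonal hu hy']
    subst e
    rw [add_right_cancel h]
    exact ⟨hne, hs⟩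
  · rintro ⟨hne, hs⟩
    exact ⟨y, hy, s, rfl, hne, hs⟩

/-- The sections of the Steiner symmetral of a convex body are the symmetrized difference sets of
the sections of the body. -/
theorem mem_lineSection_steinerSymmetral_iff_exists (hu : ‖u‖ = 1) (hK : IsCompact K)
    (hconv : Convex ℝ K) {y : EuclideanSpace ℝ (Fin n)} (hy : y ∈ (ℝ ∙ u)ᗮ) {s : ℝ} :
    s ∈ lineSection u (steinerSymmetral u K) y ↔
      ∃ a ∈ lineSection u K y, ∃ b ∈ lineSection u K y, s = (a - b) / 2 := by
  rw [mem_lineSection_steinerSymmetral_iff hu hy]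
  by_cases hne : (lineSection u K y).Nonempty
  · obtain ⟨α, β, hαβ, h⟩ := exists_lineSection_eq_Icc hu hK hconv hne
    rw [h, Real.volume_real_Icc_of_le hαβ, and_iff_right (Set.nonempty_Icc.2 hαβ), abs_le]
    constructor
    · rintro ⟨h1, h2⟩
      exact ⟨(α + β) / 2 + s, ⟨by linarith, by linarith⟩, (α + β) / 2 - s,
        ⟨by linarith, by linarith⟩, by ring⟩
    · rintro ⟨a, ⟨ha1, ha2⟩, b, ⟨hb1, hb2⟩, rfl⟩
      exact ⟨by linarith, by linarith⟩
  · exact iff_of_false (fun h => hne h.1) fun ⟨a, ha, _⟩ => hne ⟨a, ha⟩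

theorem volume_lineSection_steinerSymmetral (hu : ‖u‖ = 1) (hK : IsCompact K)
    {y : EuclideanSpace ℝ (Fin n)} (hy : y ∈ (ℝ ∙ u)ᗮ) :
    volume (lineSection u (steinerSymmetral u K) y) = volume (lineSection u K y) := by
  by_cases hne : (lineSection u K y).Nonempty
  · have h : lineSection u (steinerSymmetral u K) y =
        Set.Icc (-(volume.real (lineSection u K y) / 2))
          (volume.real (lineSection u K y) / 2) := by
      ext s
      rw [mem_lineSection_steinerSymmetral_iff hu hy, and_iff_right hne, abs_le, Set.mem_Icc]
    rw [h, Real.volume_Icc, sub_neg_eq_add, add_halves, measureReal_def,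
      ENNReal.ofReal_toReal (isCompact_lineSection hu hK y).measure_ne_top]
  · have h : lineSection u (steinerSymmetral u K) y = ∅ :=
      Set.eq_empty_of_forall_notMem fun s hs =>
        hne ((mem_lineSection_steinerSymmetral_iff hu hy).1 hs).1
    rw [h, Set.not_nonempty_iff_eq_empty.1 hne]

theorem sub_inner_smul_mem_orthogonal (hu : ‖u‖ = 1) (x : EuclideanSpace ℝ (Fin n)) :
    x - ⟪u, x⟫ • u ∈ (ℝ ∙ u)ᗮ := by
  rw [Submodule.mem_orthogonal_singleton_iff_inner_right, inner_sub_right, real_inner_smul_right,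
    real_inner_self_eq_norm_sq, hu]
  ring

/-- The Steiner symmetral of a convex body is the linear image of a convex set of pairs. -/
theorem steinerSymmetral_eq_image (hu : ‖u‖ = 1) (hK : IsCompact K) (hconv : Convex ℝ K) :
    steinerSymmetral u K =
      (fun p : EuclideanSpace ℝ (Fin n) × EuclideanSpace ℝ (Fin n) =>
          p.1 - ((⟪u, p.1⟫ + ⟪u, p.2⟫) / 2) • u) ''
        (K ×ˢ K ∩ {p | p.1 - ⟪u, p.1⟫ • u = p.2 - ⟪u, p.2⟫ • u}) := by
  ext x
  constructor
  · rintro ⟨y, hy, s, rfl, hs⟩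
    obtain ⟨a, ha, b, hb, rfl⟩ := (mem_lineSection_steinerSymmetral_iff_exists hu hK hconv hy).1
      ((mem_lineSection_steinerSymmetral_iff hu hy).2 hs)
    refine ⟨(y + a • u, y + b • u), ⟨⟨ha, hb⟩, ?_⟩, ?_⟩
    · simp only [Set.mem_ofPred_eq, inner_add_smul_of_mem_orthogonal hu hy, add_sub_cancel_right]
    · simp only [inner_add_smul_of_mem_orthogonal hu hy]
      module
  · rintro ⟨⟨p, q⟩, ⟨⟨hp, hq⟩, hpq⟩, rfl⟩
    have hpq' : p - ⟪u, p⟫ • u = q - ⟪u, q⟫ • u := hpq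
    have h := (mem_lineSection_steinerSymmetral_iff_exists hu hK hconv
      (sub_inner_smul_mem_orthogonal hu p)).2
      ⟨⟪u, p⟫, by simpa only [lineSection, Set.mem_ofPred_eq, sub_add_cancel] using hp, ⟪u, q⟫,
        by simpa only [lineSection, Set.mem_ofPred_eq, hpq', sub_add_cancel] using hq, rfl⟩
    have e : p - ((⟪u, p⟫ + ⟪u, q⟫) / 2) • u =
        p - ⟪u, p⟫ • u + ((⟪u, p⟫ - ⟪u, q⟫) / 2) • u := by module
    change p - ((⟪u, p⟫ + ⟪u, q⟫) / 2) • u ∈ steinerSymmetral u K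
    rw [e]
    exact h

theorem isCompact_steinerSymmetral (hu : ‖u‖ = 1) (hK : IsCompact K) (hconv : Convex ℝ K) :
    IsCompact (steinerSymmetral u K) := by
  rw [steinerSymmetral_eq_image hu hK hconv]
  exact ((hK.prod hK).inter_right (isClosed_eq (by fun_prop) (by fun_prop))).image (by fun_prop)

theorem convex_steinerSymmetral (hu : ‖u‖ = 1) (hK : IsCompact K) (hconv : Convex ℝ K) :
    Convex ℝ (steinerSymmetral u K) := by
  rw [steinerSymmetral_eq_image hu hK hconv]
  refine ((hconv.prod hconv).inter ?_).is_linear_image ⟨fun p q => ?_, fun c p => ?_⟩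
  · intro p hp q hq a b _ _ _
    have hp' : p.1 - ⟪u, p.1⟫ • u = p.2 - ⟪u, p.2⟫ • u := hp
    have hq' : q.1 - ⟪u, q.1⟫ • u = q.2 - ⟪u, q.2⟫ • u := hq
    simp only [Set.mem_ofPred_eq, Prod.fst_add, Prod.snd_add, Prod.smul_fst, Prod.smul_snd,
      inner_add_right, real_inner_smul_right]
    have h := congrArg₂ (· + ·) (congrArg (a • ·) hp') (congrArg (b • ·) hq')
    convert h using 1 <;> module
  · simp only [Prod.fst_add, Prod.snd_add, inner_add_right]
    module
  · simp only [Prod.smul_fst, Prod.smul_snd, real_inner_smul_right]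
    module

theorem volume_steinerSymmetral (hu : ‖u‖ = 1) (hK : IsCompact K) (hconv : Convex ℝ K) :
    volume (steinerSymmetral u K) = volume K := by
  rw [volume_eq_lintegral_lineSection hu (isCompact_steinerSymmetral hu hK hconv).measurableSet,
    volume_eq_lintegral_lineSection hu hK.measurableSet]
  exact lintegral_congr fun y => volume_lineSection_steinerSymmetral hu hK y.2

theorem mem_lineSection_add_segment_iff {y z : EuclideanSpace ℝ (Fin n)} {a c : ℝ} :
    a ∈ lineSection u (K + segment ℝ 0 (y + c • u)) z ↔
      ∃ t ∈ Set.Icc (0 : ℝ) 1, a - t * c ∈ lineSection u K (z - t • y) := by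
  have e : ∀ t : ℝ, z + a • u = z - t • y + (a - t * c) • u + t • (y + c • u) := fun t => by module
  constructor
  · rintro ⟨x, hx, w, hw, hxw⟩
    obtain ⟨t, ht, rfl⟩ := mem_segment_zero_iff.1 hw
    refine ⟨t, ht, ?_⟩
    have h : x + t • (y + c • u) = z + a • u := hxw
    rw [e t, add_left_inj] at h
    rwa [h] at hx
  · rintro ⟨t, ht, h⟩
    exact ⟨_, h, _, mem_segment_zero_iff.2 ⟨t, ht, rfl⟩, (e t).symm⟩

theorem ofReal_sub_le_volume_of_convex {A : Set ℝ} (hA : Convex ℝ A) {a b : ℝ} (ha : a ∈ A)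
    (hb : b ∈ A) : ENNReal.ofReal (b - a) ≤ volume A := by
  rw [← Real.volume_Icc]
  exact measure_mono (hA.ordConnected.out ha hb)

/-- A difference of two points of the left-hand section is the average of a difference within each
of the two right-hand sections. These are convex, so their lengths bound such differences. -/
theorem volume_lineSection_steinerSymmetral_add_segment_le (hu : ‖u‖ = 1) (hK : IsCompact K)
    (hconv : Convex ℝ K) {y z : EuclideanSpace ℝ (Fin n)} (hy : y ∈ (ℝ ∙ u)ᗮ)
    (hz : z ∈ (ℝ ∙ u)ᗮ) (s r : ℝ) :
    volume (lineSection u (steinerSymmetral u K + segment ℝ 0 (y + ((s - r) / 2) • u)) z) ≤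
      (volume (lineSection u (K + segment ℝ 0 (y + s • u)) z) +
        volume (lineSection u (K + segment ℝ 0 (y + r • u)) z)) / 2 := by
  have hconvex : ∀ c : ℝ, Convex ℝ (lineSection u (K + segment ℝ 0 (y + c • u)) z) :=
    fun c => convex_lineSection (hconv.add (convex_segment _ _)) z
  have key : ∀ a ∈ lineSection u
        (steinerSymmetral u K + segment ℝ 0 (y + ((s - r) / 2) • u)) z,
      ∀ b ∈ lineSection u (steinerSymmetral u K + segment ℝ 0 (y + ((s - r) / 2) • u)) z,
      ENNReal.ofReal (a - b) ≤ (volume (lineSection u (K + segment ℝ 0 (y + s • u)) z) +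
        volume (lineSection u (K + segment ℝ 0 (y + r • u)) z)) / 2 := by
    intro a ha b hb
    obtain ⟨t, ht, hat⟩ := mem_lineSection_add_segment_iff.1 ha
    obtain ⟨τ, hτ, hbτ⟩ := mem_lineSection_add_segment_iff.1 hb
    have hperp : ∀ c : ℝ, z - c • y ∈ (ℝ ∙ u)ᗮ := fun c =>
      Submodule.sub_mem _ hz (Submodule.smul_mem _ _ hy)
    obtain ⟨a₁, ha₁, a₂, ha₂, hae⟩ :=
      (mem_lineSection_steinerSymmetral_iff_exists hu hK hconv (hperp t)).1 hat
    obtain ⟨b₁, hb₁, b₂, hb₂, hbe⟩ :=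
      (mem_lineSection_steinerSymmetral_iff_exists hu hK hconv (hperp τ)).1 hbτ
    have hshift : ∀ c σ d : ℝ, σ ∈ Set.Icc (0 : ℝ) 1 → d ∈ lineSection u K (z - σ • y) →
        d + σ * c ∈ lineSection u (K + segment ℝ 0 (y + c • u)) z := fun c σ d hσ hd =>
      mem_lineSection_add_segment_iff.2 ⟨σ, hσ, by rwa [add_sub_cancel_right]⟩
    have h1 := ofReal_sub_le_volume_of_convex (hconvex s)
      (hshift s τ b₁ hτ hb₁) (hshift s t a₁ ht ha₁)
    have h2 := ofReal_sub_le_volume_of_convex (hconvex r)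
      (hshift r t a₂ ht ha₂) (hshift r τ b₂ hτ hb₂)
    -- The terms with index 1 carry the slope s and those with index 2 the slope r; the minus sign
    -- of the second family reverses the order of its difference.
    have hab : a - b = ((a₁ + t * s - (b₁ + τ * s)) + (b₂ + τ * r - (a₂ + t * r))) / 2 := by
      linear_combination hae - hbe
    rw [hab, ENNReal.ofReal_div_of_pos two_pos, ENNReal.ofReal_ofNat]
    exact ENNReal.div_le_div_right (ENNReal.ofReal_add_le.trans (add_le_add h1 h2)) 2
  -- Length is at most diameter, so bounding all differences of two points is enough.
  refine (Real.volume_le_diam _).trans (Metric.ediam_le fun a ha b hb => ?_)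
  rw [edist_dist, Real.dist_eq]
  rcases abs_choice (a - b) with h | h
  · rw [h]; exact key a ha b hb
  · rw [h, neg_sub]; exact key b hb a ha

/-- The sectionwise bound is integrated over u^⊥, and the equal volumes of `K` and its symmetral are
subtracted. -/
theorem segmentIncrement_steinerSymmetral_le (hu : ‖u‖ = 1) (hK : IsCompact K)
    (hconv : Convex ℝ K) {y : EuclideanSpace ℝ (Fin n)} (hy : y ∈ (ℝ ∙ u)ᗮ) (s r : ℝ) :
    segmentIncrement (steinerSymmetral u K) (y + ((s - r) / 2) • u) ≤
      (segmentIncrement K (y + s • u) + segmentIncrement K (y + r • u)) / 2 := by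
  have hadd : ∀ {L : Set (EuclideanSpace ℝ (Fin n))}, IsCompact L → ∀ θ,
      IsCompact (L + segment ℝ 0 θ) := fun hL θ => hL.add (isCompact_segment_zero θ)
  have hS := isCompact_steinerSymmetral hu hK hconv
  have h : volume (steinerSymmetral u K + segment ℝ 0 (y + ((s - r) / 2) • u)) ≤
      (volume (K + segment ℝ 0 (y + s • u)) + volume (K + segment ℝ 0 (y + r • u))) / 2 := by
    rw [volume_eq_lintegral_lineSection hu (hadd hS _).measurableSet,
      volume_eq_lintegral_lineSection hu (hadd hK (y + s • u)).measurableSet,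
      volume_eq_lintegral_lineSection hu (hadd hK (y + r • u)).measurableSet,
      ← lintegral_add_left (measurable_volume_lineSection (hadd hK _).measurableSet),
      ENNReal.div_eq_inv_mul, ← lintegral_const_mul' _ _ (by simp : (2 : ENNReal)⁻¹ ≠ ⊤)]
    refine lintegral_mono fun z => ?_
    rw [← ENNReal.div_eq_inv_mul]
    exact
      volume_lineSection_steinerSymmetral_add_segment_le hu hK hconv hy z.2 s r
  have h1 := (hadd hK (y + s • u)).measure_ne_top (μ := volume)
  have h2 := (hadd hK (y + r • u)).measure_ne_top (μ := volume)
  have h' := ENNReal.toReal_mono (ENNReal.div_ne_top (ENNReal.add_ne_top.2 ⟨h1, h2⟩) two_ne_zero) h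
  rw [ENNReal.toReal_div, ENNReal.toReal_add h1 h2, ENNReal.toReal_ofNat] at h'
  simp only [segmentIncrement, measureReal_def, volume_steinerSymmetral hu hK hconv]
  linarith

theorem volume_lineSection_polarProjectionBody_le (hu : ‖u‖ = 1) (hK : IsCompact K)
    (hconv : Convex ℝ K) {y : EuclideanSpace ℝ (Fin n)} (hy : y ∈ (ℝ ∙ u)ᗮ) :
    volume (lineSection u (polarProjectionBody K) y) ≤
      volume (lineSection u (polarProjectionBody (steinerSymmetral u K)) y) := by
  have key : ∀ a ∈ lineSection u (polarProjectionBody K) y,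
      ∀ b ∈ lineSection u (polarProjectionBody K) y,
      (a - b) / 2 ∈ lineSection u (polarProjectionBody (steinerSymmetral u K)) y := by
    intro a ha b hb
    refine (mem_polarProjectionBody_iff (isCompact_steinerSymmetral hu hK hconv)
      (convex_steinerSymmetral hu hK hconv) _).2 ?_
    have h := segmentIncrement_steinerSymmetral_le hu hK hconv hy a b
    have ha' := (mem_polarProjectionBody_iff hK hconv _).1 ha
    have hb' := (mem_polarProjectionBody_iff hK hconv _).1 hb
    linarith
  have hle : ∀ a ∈ lineSection u (polarProjectionBody K) y,
      ∀ b ∈ lineSection u (polarProjectionBody K) y, ENNReal.ofReal (a - b) ≤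
        volume (lineSection u (polarProjectionBody (steinerSymmetral u K)) y) := by
    intro a ha b hb
    -- The points (b - a)/2 and (a - b)/2 are at signed distance a - b.
    have h := ofReal_sub_le_volume_of_convex (convex_lineSection (convex_polarBody _) y)
      (key b hb a ha) (key a ha b hb)
    rwa [show (a - b) / 2 - (b - a) / 2 = a - b by ring] at h
  refine (Real.volume_le_diam _).trans (Metric.ediam_le fun a ha b hb => ?_)
  rw [edist_dist, Real.dist_eq]
  rcases abs_choice (a - b) with h | h
  · rw [h]; exact hle a ha b hb
  · rw [h, neg_sub]; exact hle b hb a ha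

end Steiner

theorem mainTheorem11 (n : ℕ) (K : ConvexBody (EuclideanSpace ℝ (Fin n)))
    (hK : (interior (K : Set (EuclideanSpace ℝ (Fin n)))).Nonempty)
    (u : EuclideanSpace ℝ (Fin n)) (hu : ‖u‖ = 1) :
    (∀ y ∈ (ℝ ∙ u)ᗮ,
      volume (lineSection u (polarProjectionBody (K : Set (EuclideanSpace ℝ (Fin n)))) y) ≤
        volume (lineSection u
          (polarProjectionBody (steinerSymmetral u (K : Set (EuclideanSpace ℝ (Fin n))))) y)) ∧
    volume (polarProjectionBody (K : Set (EuclideanSpace ℝ (Fin n)))) ≤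
      volume (polarProjectionBody
        (steinerSymmetral u (K : Set (EuclideanSpace ℝ (Fin n))))) := by
  have h : ∀ y ∈ (ℝ ∙ u)ᗮ,
      volume (lineSection u (polarProjectionBody (K : Set (EuclideanSpace ℝ (Fin n)))) y) ≤
        volume (lineSection u
          (polarProjectionBody (steinerSymmetral u (K : Set (EuclideanSpace ℝ (Fin n))))) y) :=
    fun y hy => volume_lineSection_polarProjectionBody_le hu K.isCompact K.convex hy
  refine ⟨h, ?_⟩
  rw [polarProjectionBody, polarProjectionBody,
    volume_eq_lintegral_lineSection hu (isClosed_polarBody _).measurableSet,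
    volume_eq_lintegral_lineSection hu (isClosed_polarBody _).measurableSet]
  exact lintegral_mono fun y => h y y.2
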